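/- **Conventions.** A PDA is a nondeterministic pushdown automaton with finite state set $Q$, finite stack alphabet $\Gamma$ and transition function $\delta : Q\times(\Sigma\cup\{\varepsilon\})\times(\Gamma\cup\{\varepsilon\})\to\mathcal P\bigl(Q\times(\Gamma\cup\{\varepsilon\})\bigr)$: a move reads at most one input symbol, pops at most one stack symbol and pushes at most one stack symbol. It starts with the empty stack and accepts by final state. Its size is the number of states plus the number of stack symbols. An LBA is a nondeterministic Turing machine that works only on the cells holding its input and two end markers, which it never overwrites; it accepts by reaching an accepting state. Its size is the number of states plus the number of tape symbols (input symbols and end markers included). "For almost all $n$" means for all but finitely many $n\in\mathbb N$. **Theorem.** For $n\in\mathbb N$ let $$A_n=\{\,w\$w : w\in\{a,b\}^*,\ |w|=2^n\,\}$$ over the alphabet $\{a,b,\$\}$. There are constants $c,C>0$ such that for almost all $n$ the following hold. 1. $A_n$ is recognized by some PDA, and every PDA that recognizes $A_n$ has size at least $2^{2^{cn}}$. 2. There is an LBA of size at most $Cn$ that recognizes $A_n$. -/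

import Mathlib

open Filter

/-- A nondeterministic pushdown automaton with input alphabet `α`, states `Q` and stack alphabet `Γ`
(`Q`, `Γ` are taken finite where automata are used). `(p, Y) ∈ δ q a X` is a transition from state
`q` to state `p` which reads `a` (nothing if `a = none`), pops `X` from the top of the stack (nothing
if `X = none`) and then pushes `Y` (nothing if `Y = none`): `δ : Q × Σ_ε × Γ_ε → 𝒫(Q × Γ_ε)`. -/
structure PDA (α Q Γ : Type) where
  start : Q
  accept : Set Q
  δ : Q → Option α → Option Γ → Set (Q × Option Γ)

namespace PDA

variable {α Q Γ : Type}

/-- One move. A configuration is the state, the unread input and the stack (top first). -/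
inductive Step (P : PDA α Q Γ) : Q × List α × List Γ → Q × List α × List Γ → Prop
  | mk (q p : Q) (a : Option α) (X Y : Option Γ) (x : List α) (γ : List Γ)
      (h : (p, Y) ∈ P.δ q a X) :
      Step P (q, a.toList ++ x, X.toList ++ γ) (p, x, Y.toList ++ γ)

/-- The language recognized: starting with the empty stack, some run reads the whole input and ends
in an accepting state. -/
def language (P : PDA α Q Γ) : Language α :=
  {w | ∃ q ∈ P.accept, ∃ γ : List Γ, Relation.ReflTransGen P.Step (P.start, w, []) (q, [], γ)}

/-- The size: number of states plus number of stack symbols. -/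
def size [Fintype Q] [Fintype Γ] (_P : PDA α Q Γ) : ℕ :=
  Fintype.card Q + Fintype.card Γ

end PDA

/-- A (nondeterministic) linear bounded automaton with input alphabet `α`, states `Q` and tape
alphabet `Γ`, which contains the input alphabet (through `inp`) and two end markers.
`(p, Y, d) ∈ δ q X` is a transition which in state `q`, scanning `X`, writes `Y`, moves the head one
cell in direction `d` and enters state `p`. End markers are never overwritten and never written
elsewhere. -/
structure LBA (α Q Γ : Type) where
  inp : α → Γ
  inp_injective : Function.Injective inp
  lend : Γ
  rend : Γ
  lend_ne_rend : lend ≠ rend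
  inp_ne_lend : ∀ a, inp a ≠ lend
  inp_ne_rend : ∀ a, inp a ≠ rend
  start : Q
  accept : Set Q
  δ : Q → Γ → Set (Q × Γ × Turing.Dir)
  marker : ∀ q X p Y d, (p, Y, d) ∈ δ q X → (Y = lend ↔ X = lend) ∧ (Y = rend ↔ X = rend)

namespace LBA

variable {α Q Γ : Type}

/-- One move. In a configuration `(q, u, v)` the state is `q`, the tape content is
`u.reverse ++ v`, and the head scans the first cell of `v`. There are no other cells, so a move off
either end of the tape is impossible. -/
inductive Step (M : LBA α Q Γ) : Q × List Γ × List Γ → Q × List Γ × List Γ → Prop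
  | right (q p : Q) (X Y Z : Γ) (u v : List Γ) (h : (p, Y, Turing.Dir.right) ∈ M.δ q X) :
      Step M (q, u, X :: Z :: v) (p, Y :: u, Z :: v)
  | left (q p : Q) (X Y Z : Γ) (u v : List Γ) (h : (p, Y, Turing.Dir.left) ∈ M.δ q X) :
      Step M (q, Z :: u, X :: v) (p, u, Z :: Y :: v)

/-- The language recognized: started on the left end marker of the tape that holds the input between
the two end markers, some run reaches an accepting state. -/
def language (M : LBA α Q Γ) : Language α :=
  {w | ∃ q ∈ M.accept, ∃ u v : List Γ,
    Relation.ReflTransGen M.Step (M.start, [], M.lend :: (w.map M.inp ++ [M.rend])) (q, u, v)}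

/-- The size: number of states plus number of tape symbols (input symbols and end markers
included). -/
def size [Fintype Q] [Fintype Γ] (_M : LBA α Q Γ) : ℕ :=
  Fintype.card Q + Fintype.card Γ

end LBA

/-- The language `{w$w : w ∈ {a,b}*, |w| = m}`; the letters `a`, `b` are `some false`, `some true`,
and `$` is `none`. -/
def markedCopies (m : ℕ) : Language (Option Bool) :=
  {x | ∃ w : List Bool, w.length = m ∧ x = w.map some ++ none :: w.map some}

/-!
**Pushdown automata.** A finite language is recognized by its trie. For the lower bound, a pushdown
automaton that empties its stack at the end is read as a context-free grammar with nonterminals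
`(p, X, q)`, whose derivations are the runs from `p` to `q` with net effect of popping `X`
(`PDA.Derives`, `PDA.mem_language_iff_derives`). Its rules are at most binary, so in a derivation of
`w$w` with `|w| = m` some subderivation yields a segment of length in `(t, 2t]`, where `2t ≤ m`
(`PDA.Derives.exists_segment`). If two words `w$w` and `w'$w'` share nonterminal, position and length
of this segment, then the segments may be interchanged, and the result is again of the form `v$v`.
A segment of length at most `m` contains at most one of the two copies of a position, so `w` and
`w'` agree on all positions with a copy in the segment, of which there are at least `t`
(`eq_of_interchange`, `le_card_positions_of_segment`). So each of the
`(|Q| + 1)² (|Γ| + 1) (2m + 2)²` classes has at most `2 ^ (m - t)` members, while there are `2 ^ m`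
words. With `m = 2 ^ n` and `t = m / 2` the size is at least `2 ^ √m`, for large `n`.

**Linear bounded automata.** The automaton sweeps over its tape again and again. Each sweep erases
the first remaining letter on both sides of the marker, after comparing the two, and at the same time
increments an `n`-bit counter held on a second track of the first `n` cells. The first sweep leaves
the counter unchanged, so the counter overflows in the first sweep that finds nothing to erase
exactly if `2 ^ n` letters have been erased. Only the position inside the counter needs `O(n)`
states; the tape alphabet is fixed. `Sweeper.mem_toLBA_language` reduces automata that sweep to
iterated Mealy machines, and `copySweeper_sound` and `copySweeper_complete` analyse the machine.
-/

/-! ### Recognizing a finite language -/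

namespace PDA

variable {α Q Γ : Type}

/-- The trie of a finite language, as a pushdown automaton that never uses its stack: the state is
the prefix read so far, and words longer than `k` have no run. -/
def trie (L : Language α) (k : ℕ) : PDA α {l : List α // l.length ≤ k} Empty where
  start := ⟨[], by simp⟩
  accept := {l | l.1 ∈ L}
  δ := fun l a _ => {r | r.2 = none ∧ r.1.1 = l.1 ++ a.toList}

theorem trie_invariant {L : Language α} {k : ℕ} {c d}
    (h : Relation.ReflTransGen (trie L k).Step c d) : c.1.1 ++ c.2.1 = d.1.1 ++ d.2.1 := by
  induction h with
  | refl => rfl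
  | tail _ h ih =>
    rw [ih]
    obtain ⟨q, p, a, X, Y, x, γ, h⟩ := h
    have h : p.1 = q.1 ++ a.toList := h.2
    simp [h]

theorem trie_run {L : Language α} {k : ℕ} (w u : List α) (h : (u ++ w).length ≤ k) :
    Relation.ReflTransGen (trie L k).Step (⟨u, by simp at h; omega⟩, w, [])
      (⟨u ++ w, h⟩, [], []) := by
  induction w generalizing u with
  | nil => simp [Relation.ReflTransGen.refl]
  | cons a w ih =>
    have h' : ((u ++ [a]) ++ w).length ≤ k := by simpa using h
    have := ih (u ++ [a]) h'
    simp only [List.append_assoc, List.singleton_append] at this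
    refine Relation.ReflTransGen.head ?_ this
    exact Step.mk (P := trie L k) _ _ (some a) none none w [] ⟨rfl, rfl⟩

theorem trie_language (L : Language α) (k : ℕ) (hL : ∀ w ∈ L, w.length ≤ k) :
    (trie L k).language = L := by
  ext w
  constructor
  · rintro ⟨q, hq, γ, h⟩
    have := trie_invariant h
    simp only [List.append_nil] at this
    have hq : q.1 ∈ L := hq
    rw [← this] at hq
    simpa [trie] using hq
  · intro hw
    exact ⟨⟨w, hL w hw⟩, hw, [], trie_run (L := L) w [] (hL w hw)⟩

/-! ### Runs of pushdown automata as derivations of a grammar -/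

/-- `Derives P p X q u`: some run of `P` from state `p` to state `q` reads exactly `u` and, in net
effect, removes the stack content `X` (at most one symbol) without looking below it. The triples
`(p, X, q)` are the nonterminals of the context-free grammar of `P`, and the constructors are its
rules. -/
inductive Derives (P : PDA α Q Γ) : Q → Option Γ → Q → List α → Prop
  | refl (q : Q) : Derives P q none q []
  | step {p p' q : Q} {a : Option α} {X Y : Option Γ} {u : List α} (h : (p', Y) ∈ P.δ p a X)
      (hu : Derives P p' Y q u) : Derives P p X q (a.toList ++ u)
  | comp {p r q : Q} {X : Option Γ} {u v : List α} (hu : Derives P p none r u)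
      (hv : Derives P r X q v) : Derives P p X q (u ++ v)

theorem Derives.run {P : PDA α Q Γ} {p q : Q} {X : Option Γ} {u : List α}
    (h : Derives P p X q u) (x : List α) (γ : List Γ) :
    Relation.ReflTransGen P.Step (p, u ++ x, X.toList ++ γ) (q, x, γ) := by
  induction h generalizing x γ with
  | refl => exact .refl
  | step h _ ih =>
    rw [List.append_assoc]
    exact .head (Step.mk _ _ _ _ _ _ _ h) (ih x γ)
  | comp _ _ ihu ihv =>
    rw [List.append_assoc]
    exact (ihu _ _).trans (ihv x γ)

/-- `DerivesStack P q p γ u`: reading `u` and removing all of `γ` symbol by symbol leads from `p`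
to `q`. -/
def DerivesStack (P : PDA α Q Γ) (q : Q) : Q → List Γ → List α → Prop
  | p, [], u => Derives P p none q u
  | p, X :: γ, u => ∃ r u₁ u₂, u = u₁ ++ u₂ ∧ Derives P p (some X) r u₁ ∧ DerivesStack P q r γ u₂

theorem DerivesStack.prepend {P : PDA α Q Γ} {p q r : Q} {γ : List Γ} {u v : List α}
    (hu : Derives P p none r u) (hv : DerivesStack P q r γ v) :
    DerivesStack P q p γ (u ++ v) := by
  cases γ with
  | nil => exact .comp hu hv
  | cons X γ =>
    obtain ⟨r', v₁, v₂, rfl, h₁, h₂⟩ := hv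
    exact ⟨r', u ++ v₁, v₂, by simp, .comp hu h₁, h₂⟩

theorem derivesStack_of_run {P : PDA α Q Γ} {q : Q} {c}
    (h : Relation.ReflTransGen P.Step c (q, [], [])) : DerivesStack P q c.1 c.2.2 c.2.1 := by
  induction h using Relation.ReflTransGen.head_induction_on with
  | refl => exact .refl q
  | head h _ ih =>
    obtain ⟨p, p', a, X, Y, x, γ, h⟩ := h
    -- a move that pops nothing is a derivation that precedes the removal of the old stack
    cases X with
    | none =>
      cases Y with
      | none =>
        have := (Derives.step h (.refl p')).comp (.refl p')
        simp only [List.append_nil] at this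
        exact DerivesStack.prepend this ih
      | some Y =>
        obtain ⟨r, x₁, x₂, hx, h₁, h₂⟩ := ih
        simp only at hx
        subst hx
        have := DerivesStack.prepend (.step h h₁) h₂
        rwa [List.append_assoc] at this
    | some X =>
      cases Y with
      | none => exact ⟨p', a.toList, x, rfl, by simpa using Derives.step h (.refl p'), ih⟩
      | some Y =>
        obtain ⟨r, x₁, x₂, hx, h₁, h₂⟩ := ih
        simp only at hx
        subst hx
        exact ⟨r, a.toList ++ x₁, x₂, by simp, .step h h₁, h₂⟩

theorem derives_iff_run {P : PDA α Q Γ} {p q : Q} {u : List α} :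
    Derives P p none q u ↔ Relation.ReflTransGen P.Step (p, u, []) (q, [], []) :=
  ⟨fun h => by simpa using h.run [] [], fun h => derivesStack_of_run h⟩

/-- The automaton `P` with an additional state `none`, which is entered from accepting states and
empties the stack; it turns acceptance by final state into acceptance by empty stack. -/
def emptying (P : PDA α Q Γ) : PDA α (Option Q) Γ where
  start := some P.start
  accept := {none}
  δ
    | some q, a, X => {r | (∃ p Y, (p, Y) ∈ P.δ q a X ∧ r = (some p, Y)) ∨
        (q ∈ P.accept ∧ a = none ∧ X = none ∧ r = (none, none))}
    | none, a, _ => {r | a = none ∧ r = (none, none)}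

theorem emptying_pop (P : PDA α Q Γ) (γ : List Γ) :
    Relation.ReflTransGen P.emptying.Step (none, [], γ) (none, [], []) := by
  induction γ with
  | nil => exact .refl
  | cons X γ ih =>
    exact .head (Step.mk (P := P.emptying) none none none (some X) none [] γ ⟨rfl, rfl⟩) ih

theorem emptying_run {P : PDA α Q Γ} {c d} (h : Relation.ReflTransGen P.Step c d) :
    Relation.ReflTransGen P.emptying.Step (some c.1, c.2) (some d.1, d.2) := by
  induction h with
  | refl => exact .refl
  | tail _ h ih =>
    obtain ⟨q, p, a, X, Y, x, γ, h⟩ := h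
    exact ih.tail (Step.mk (P := P.emptying) _ _ a X Y x γ (.inl ⟨p, Y, h, rfl⟩))

theorem exists_accepting_run_of_emptying {P : PDA α Q Γ} {c}
    (h : Relation.ReflTransGen P.emptying.Step c (none, [], [])) :
    match c.1 with
    | none => c.2.1 = []
    | some p => ∃ q ∈ P.accept, ∃ γ, Relation.ReflTransGen P.Step (p, c.2) (q, [], γ) := by
  induction h using Relation.ReflTransGen.head_induction_on with
  | refl => rfl
  | head h _ ih =>
    obtain ⟨q, p, a, X, Y, x, γ, h⟩ := h
    cases q with
    | none =>
      obtain ⟨rfl, h⟩ := h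
      simp only [Prod.mk.injEq] at h
      obtain ⟨rfl, rfl⟩ := h
      simpa using ih
    | some q =>
      obtain ⟨p, Y, h, h'⟩ | ⟨hq, rfl, rfl, h⟩ := h
      · simp only [Prod.mk.injEq] at h'
        obtain ⟨rfl, rfl⟩ := h'
        obtain ⟨f, hf, γ', ih⟩ := ih
        exact ⟨f, hf, γ', .head (Step.mk _ _ _ _ _ _ _ h) ih⟩
      · simp only [Prod.mk.injEq] at h
        obtain ⟨rfl, rfl⟩ := h
        simp only at ih
        subst ih
        exact ⟨q, hq, γ, .refl⟩

theorem mem_language_iff_derives {P : PDA α Q Γ} {w : List α} :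
    w ∈ P.language ↔ Derives P.emptying (some P.start) none none w := by
  rw [derives_iff_run]
  constructor
  · rintro ⟨q, hq, γ, h⟩
    refine (emptying_run h).trans (.head ?_ (P.emptying_pop γ))
    exact Step.mk (P := P.emptying) (some q) none none none none [] γ (.inr ⟨hq, rfl, rfl, rfl⟩)
  · intro h
    exact exists_accepting_run_of_emptying h

/-! ### Interchange of segments -/

/-- Every derivation of a long word has a subderivation whose yield `y` has length in `(t, 2t]`, and
which may be replaced by any other derivation from the same nonterminal. -/
theorem Derives.exists_segment {P : PDA α Q Γ} {p q : Q} {X : Option Γ} {u : List α} {t : ℕ}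
    (ht : 1 ≤ t) (h : Derives P p X q u) (hu : t < u.length) :
    ∃ x y z p' X' q', u = x ++ y ++ z ∧ t < y.length ∧ y.length ≤ 2 * t ∧ Derives P p' X' q' y ∧
      ∀ y', Derives P p' X' q' y' → Derives P p X q (x ++ y' ++ z) := by
  induction h with
  | refl => simp at hu
  | @step p p' q a X Y u h hd ih =>
    by_cases hs : (a.toList ++ u).length ≤ 2 * t
    · exact ⟨[], _, [], p, X, q, by simp, hu, hs, .step h hd, by simp⟩
    · have ha : a.toList.length ≤ 1 := by cases a <;> simp
      rw [List.length_append] at hs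
      obtain ⟨x, y, z, p₁, X₁, q₁, rfl, h₁, h₂, h₃, h₄⟩ := ih (by omega)
      exact ⟨a.toList ++ x, y, z, p₁, X₁, q₁, by simp, h₁, h₂, h₃,
        fun y' hy' => by simpa using Derives.step h (h₄ y' hy')⟩
  | @comp p r q X u v hdu hdv ihu ihv =>
    by_cases hs : (u ++ v).length ≤ 2 * t
    · exact ⟨[], _, [], p, X, q, by simp, hu, hs, .comp hdu hdv, by simp⟩
    · rw [List.length_append] at hs
      by_cases hut : t < u.length
      · obtain ⟨x, y, z, p₁, X₁, q₁, rfl, h₁, h₂, h₃, h₄⟩ := ihu hut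
        exact ⟨x, y, z ++ v, p₁, X₁, q₁, by simp, h₁, h₂, h₃,
          fun y' hy' => by simpa using Derives.comp (h₄ y' hy') hdv⟩
      · obtain ⟨x, y, z, p₁, X₁, q₁, rfl, h₁, h₂, h₃, h₄⟩ := ihv (by omega)
        exact ⟨u ++ x, y, z, p₁, X₁, q₁, by simp, h₁, h₂, h₃,
          fun y' hy' => by simpa using Derives.comp hdu (h₄ y' hy')⟩

end PDA

theorem length_of_mem_markedCopies {m : ℕ} {x : List (Option Bool)} (h : x ∈ markedCopies m) :
    x.length = 2 * m + 1 := by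
  obtain ⟨w, hw, rfl⟩ := h
  simp [hw]
  omega

theorem getElem?_of_mem_markedCopies {m k : ℕ} {x : List (Option Bool)} (h : x ∈ markedCopies m)
    (hk : k < m) : x[k]? = x[m + 1 + k]? := by
  obtain ⟨w, hw, rfl⟩ := h
  rw [List.getElem?_append_left (by simp [hw, hk]), List.getElem?_append_right (by simp [hw]; omega)]
  simp only [List.length_map, hw]
  rw [show m + 1 + k - m = k + 1 by omega, List.getElem?_cons_succ]

/-- The word `w$w`, for `w` given as a function. -/
def markedCopy {m : ℕ} (w : Fin m → Bool) : List (Option Bool) :=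
  (List.ofFn w).map some ++ none :: (List.ofFn w).map some

theorem markedCopy_mem {m : ℕ} (w : Fin m → Bool) : markedCopy w ∈ markedCopies m :=
  ⟨List.ofFn w, by simp, rfl⟩

theorem markedCopy_getElem? {m : ℕ} (w : Fin m → Bool) (k : Fin m) :
    (markedCopy w)[(k : ℕ)]? = some (some (w k)) := by
  unfold markedCopy
  rw [List.getElem?_append_left (by simp)]
  simp

theorem getElem?_of_segments {β : Type} {x y z x' y' z' : List β} (hx : x.length = x'.length)
    (hy : y.length = y'.length) (j : ℕ) :
    (x ++ y' ++ z)[j]? = if x.length ≤ j ∧ j < x.length + y.length then (x' ++ y' ++ z')[j]?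
      else (x ++ y ++ z)[j]? := by
  simp only [List.getElem?_append, List.length_append]
  grind

/-- If the interchange of two equally placed segments of `w$w` and `w'$w'` yields a word of the same
form, then `w` and `w'` agree at every position of which exactly one of the two copies lies in the
segment. -/
theorem eq_of_interchange {m : ℕ} {w w' : Fin m → Bool} {x y z x' y' z' : List (Option Bool)}
    (hw : markedCopy w = x ++ y ++ z) (hw' : markedCopy w' = x' ++ y' ++ z')
    (hx : x.length = x'.length) (hy : y.length = y'.length) (hm : x ++ y' ++ z ∈ markedCopies m)
    (k : Fin m)
    (hk : (x.length ≤ k ∧ k < x.length + y.length) ↔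
      ¬ (x.length ≤ m + 1 + k ∧ m + 1 + k < x.length + y.length)) : w k = w' k := by
  have h := getElem?_of_mem_markedCopies hm k.2
  rw [getElem?_of_segments (z' := z') hx hy, getElem?_of_segments (z' := z') hx hy, ← hw, ← hw',
    ← getElem?_of_mem_markedCopies (markedCopy_mem w) k.2,
    ← getElem?_of_mem_markedCopies (markedCopy_mem w') k.2, markedCopy_getElem?,
    markedCopy_getElem?] at h
  by_cases h1 : x.length ≤ k ∧ k < x.length + y.length
  · rw [if_pos h1, if_neg (hk.1 h1)] at h
    simpa using h.symm
  · rw [if_neg h1, if_pos (by tauto)] at h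
    simpa using h

theorem card_le_two_pow_of_agree {ι : Type} [Fintype ι] [DecidableEq ι] (S : Finset (ι → Bool))
    (K : Finset ι) (h : ∀ w ∈ S, ∀ w' ∈ S, ∀ k ∈ K, w k = w' k) :
    S.card ≤ 2 ^ (Fintype.card ι - K.card) := by
  have hc : (Finset.univ : Finset ({k // k ∈ Kᶜ} → Bool)).card = 2 ^ (Fintype.card ι - K.card) := by
    simp
  rw [← hc]
  refine Finset.card_le_card_of_injOn (fun w k => w k.1) (by simp) ?_
  intro w hw w' hw' hww
  funext k
  by_cases hk : k ∈ K
  · exact h w hw w' hw' k hk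
  · exact congrFun hww ⟨k, by simpa using hk⟩

/-- A segment `[i, i + l)` of `w$w` with `t < l ≤ m` contains a copy of at least `t` positions of
`w`: at most one cell of it holds the marker, and it is too short to contain both copies of a
position. -/
theorem le_card_positions_of_segment {m t i l : ℕ} (htl : t < l) (hlm : l ≤ m)
    (hil : i + l ≤ 2 * m + 1) :
    t ≤ (Finset.univ.filter fun k : Fin m =>
      (i ≤ k ∧ k < i + l) ∨ (i ≤ m + 1 + k ∧ m + 1 + k < i + l)).card := by
  set K := Finset.univ.filter fun k : Fin m =>
      (i ≤ k ∧ k < i + l) ∨ (i ≤ m + 1 + k ∧ m + 1 + k < i + l) with hK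
  rw [← Finset.card_map Fin.valEmbedding]
  have h1 : t ≤ ((Finset.Ico i (i + l)).erase m).card := by
    have := Finset.pred_card_le_card_erase (s := Finset.Ico i (i + l)) (a := m)
    simp at this
    omega
  refine h1.trans (Finset.card_le_card_of_injOn (fun k => if k < m then k else k - (m + 1)) ?_ ?_)
  · intro k hk
    simp only [Finset.coe_erase, Finset.coe_Ico, Set.mem_sdiff, Set.mem_Ico,
      Set.mem_singleton_iff] at hk
    simp only [Finset.coe_map, Set.mem_image, Finset.mem_coe, Fin.valEmbedding_apply]
    have hlt : (if k < m then k else k - (m + 1)) < m := by split_ifs <;> omega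
    refine ⟨⟨_, hlt⟩, ?_, rfl⟩
    simp only [hK, Finset.mem_filter, Finset.mem_univ, true_and]
    split_ifs <;> omega
  · intro k hk k' hk' h
    simp only [Finset.coe_erase, Finset.coe_Ico, Set.mem_sdiff, Set.mem_Ico,
      Set.mem_singleton_iff] at hk hk'
    simp only at h
    split_ifs at h <;> omega

namespace PDA

variable {Q Γ : Type}

/-- The words `w$w` are classified by the nonterminal, the position and the length of a segment as
in `Derives.exists_segment`; the words of one class agree on at least `t` letters of `w`. -/
theorem two_pow_le_of_language_eq_markedCopies [Fintype Q] [Fintype Γ]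
    (P : PDA (Option Bool) Q Γ) {m t : ℕ} (ht : 1 ≤ t) (htm : 2 * t ≤ m)
    (hP : P.language = markedCopies m) :
    2 ^ m ≤ 2 ^ (m - t) * ((Fintype.card Q + 1) ^ 2 * (Fintype.card Γ + 1) * (2 * m + 2) ^ 2) := by
  classical
  have hseg : ∀ w : Fin m → Bool, ∃ x y z p X q, markedCopy w = x ++ y ++ z ∧ t < y.length ∧
      y.length ≤ 2 * t ∧ Derives P.emptying p X q y ∧
      ∀ y', Derives P.emptying p X q y' → x ++ y' ++ z ∈ markedCopies m := by
    intro w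
    have hw := markedCopy_mem w
    have hlen := length_of_mem_markedCopies hw
    simp only [← hP, mem_language_iff_derives] at hw ⊢
    exact hw.exists_segment ht (by omega)
  choose x y z p X q hxyz hty hyt hd hswap using hseg
  have hlen : ∀ w, (x w).length + (y w).length + (z w).length = 2 * m + 1 := fun w => by
    have := length_of_mem_markedCopies (markedCopy_mem w)
    rw [hxyz] at this
    simpa [add_assoc] using this
  let key : (Fin m → Bool) → (Option Q × Option Γ × Option Q) × Fin (2 * m + 2) × Fin (2 * m + 2) :=
    fun w => ((p w, X w, q w), ⟨(x w).length, by have := hlen w; omega⟩,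
      ⟨(y w).length, by have := hlen w; omega⟩)
  have hfib : ∀ κ ∈ (Finset.univ : Finset (Fin m → Bool)).image key,
      (Finset.univ.filter fun w => key w = κ).card ≤ 2 ^ (m - t) := by
    intro κ hκ
    obtain ⟨w₀, -, rfl⟩ := Finset.mem_image.1 hκ
    have hK := le_card_positions_of_segment (i := (x w₀).length) (hty w₀) ((hyt w₀).trans htm)
      (by have := hlen w₀; omega)
    refine (card_le_two_pow_of_agree _ _ ?_).trans (Nat.pow_le_pow_right two_pos
      (show Fintype.card (Fin m) - _ ≤ m - t from by
        rw [Fintype.card_fin]; exact Nat.sub_le_sub_left hK m))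
    intro w hw w' hw' k hk
    simp only [Finset.mem_filter, Finset.mem_univ, true_and, key, Prod.mk.injEq,
      Fin.mk.injEq] at hw hw' hk
    obtain ⟨⟨hp, hX, hq⟩, hx, hy⟩ := hw
    obtain ⟨⟨hp', hX', hq'⟩, hx', hy'⟩ := hw'
    have hsw : x w ++ y w' ++ z w ∈ markedCopies m := by
      apply hswap
      have := hd w'
      rwa [hp', hX', hq', ← hp, ← hX, ← hq] at this
    refine eq_of_interchange (hxyz w) (hxyz w') (hx.trans hx'.symm) (hy.trans hy'.symm) hsw k ?_
    have := hyt w₀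
    rw [hx, hy]
    omega
  have h := Finset.card_le_mul_card_image (f := key) Finset.univ _ hfib
  have h2 := Finset.card_le_univ ((Finset.univ : Finset (Fin m → Bool)).image key)
  simp only [Finset.card_univ, Fintype.card_pi, Fintype.card_bool, Finset.prod_const,
    Fintype.card_fin, Fintype.card_prod, Fintype.card_option] at h h2
  refine h.trans (Nat.mul_le_mul_left _ (h2.trans (le_of_eq ?_)))
  ring

end PDA

/-! ### Linear bounded automata that sweep over the tape -/

/-- The run of a letter-to-letter transducer (Mealy machine): the final state and the output. -/
def mealyRun {S C : Type} (step : S → C → S × C) : S → List C → S × List C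
  | s, [] => (s, [])
  | s, c :: l => ((mealyRun step (step s c).1 l).1, (step s c).2 :: (mealyRun step (step s c).1 l).2)

theorem mealyRun_length {S C : Type} (step : S → C → S × C) (s : S) (l : List C) :
    (mealyRun step s l).2.length = l.length := by
  induction l generalizing s with
  | nil => rfl
  | cons c l ih => simp [mealyRun, ih]

/-- A Mealy machine whose output is its next input: it rewrites the
whole tape again and again in sweeps from left to right. The first sweep starts in state `first`,
the later ones in `again`; a sweep that ends in state `s` is the last one and accepts if
`verdict s = some true`, is followed by another one if `verdict s = some false`, and rejects if
`verdict s = none`. -/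
structure Sweeper (S C : Type) where
  step : S → C → S × C
  first : S
  again : S
  verdict : S → Option Bool

namespace Sweeper

variable {α S C : Type}

/-- One sweep: the final state and the new tape. -/
abbrev sweep (T : Sweeper S C) : S → List C → S × List C :=
  mealyRun T.step

/-- The iteration of sweeps that begins in state `s` on a given tape accepts. -/
inductive Accepts (T : Sweeper S C) : S → List C → Prop
  | accept {s : S} {l : List C} (h : T.verdict (T.sweep s l).1 = some true) : Accepts T s l
  | again {s : S} {l : List C} (h : T.verdict (T.sweep s l).1 = some false)
      (h' : Accepts T T.again (T.sweep s l).2) : Accepts T s l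

/-- A linear bounded automaton that performs the sweeps. State `inl s` sweeps to the right,
`inr false` returns to the left end, `inr true` accepts; `inl false`, `inl true` are the end
markers. -/
def toLBA (T : Sweeper S C) (inp : α → C) (hinp : Function.Injective inp) :
    LBA α (S ⊕ Bool) (Bool ⊕ C) where
  inp := fun a => .inr (inp a)
  inp_injective := Sum.inr_injective.comp hinp
  lend := .inl false
  rend := .inl true
  lend_ne_rend := by simp
  inp_ne_lend := by simp
  inp_ne_rend := by simp
  start := .inl T.first
  accept := {.inr true}
  δ
    | .inl s, .inl false => {(.inl s, .inl false, .right)}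
    | .inl s, .inl true => {r | ∃ b, T.verdict s = some b ∧ r = (.inr b, .inl true, .left)}
    | .inl s, .inr c => {(.inl (T.step s c).1, .inr (T.step s c).2, .right)}
    | .inr false, .inl false => {(.inl T.again, .inl false, .right)}
    | .inr false, .inl true => {(.inr false, .inl true, .left)}
    | .inr false, .inr c => {(.inr false, .inr c, .left)}
    | .inr true, _ => ∅
  marker := by
    rintro (s | _ | _) ((_ | _) | c) p Y d h <;> simp <;> grind

variable (T : Sweeper S C) (inp : α → C) (hinp : Function.Injective inp)

/-- A property of all configurations from which acceptance can be reached: the iteration of sweeps,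
continued from the configuration, accepts. In a sweep, `done` is the output so far, and `l` what is
still to be read; on the left end marker the sweep is about to begin; on the way back the position
of the head is irrelevant. Nothing is required of configurations that do not arise in this way. -/
def Promising (T : Sweeper S C) : (S ⊕ Bool) × List (Bool ⊕ C) × List (Bool ⊕ C) → Prop
  | (.inl s, u, v) => ∀ l,
      (u = [] → v = .inl false :: (l.map .inr ++ [.inl true]) → T.Accepts s l) ∧
      ∀ done, u = (done.map .inr).reverse ++ [.inl false] → v = l.map .inr ++ [.inl true] →
        T.verdict (T.sweep s l).1 = some true ∨ T.verdict (T.sweep s l).1 = some false ∧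
          T.Accepts T.again (done ++ (T.sweep s l).2)
  | (.inr false, u, v) => ∀ l, u.reverse ++ v = .inl false :: (l.map .inr ++ [.inl true]) →
      T.Accepts T.again l
  | (.inr true, _, _) => True

theorem accepts_of_sweep {s : S} {l : List C}
    (h : T.verdict (T.sweep s l).1 = some true ∨ T.verdict (T.sweep s l).1 = some false ∧
      T.Accepts T.again ([] ++ (T.sweep s l).2)) : T.Accepts s l :=
  h.elim .accept fun h => .again h.1 h.2

theorem promising_of_step {c d} (h : (T.toLBA inp hinp).Step c d) (hd : T.Promising d) :
    T.Promising c := by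
  cases h with
  | right q p X Y Z u v h =>
    rcases q with s | _ | _ <;> rcases X with (_ | _) | c <;>
      simp [toLBA] at h
    · obtain ⟨rfl, rfl⟩ := h
      refine fun l => ⟨?_, ?_⟩
      · rintro rfl hv
        exact T.accepts_of_sweep ((hd l).2 [] rfl (by simpa using hv))
      · intro done _ hv
        cases l <;> simp at hv
    · obtain ⟨rfl, rfl⟩ := h
      refine fun l => ⟨?_, ?_⟩
      · rintro rfl hv
        simp at hv
      · rintro done rfl hv
        cases l with
        | nil => simp at hv
        | cons c' l =>
          simp at hv
          obtain ⟨rfl, hv⟩ := hv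
          have := (hd l).2 (done ++ [(T.step s c).2]) (by simp) (by simpa using hv)
          simpa [mealyRun] using this
    · obtain ⟨rfl, rfl⟩ := h
      intro l hl
      cases u using List.reverseRecOn with
      | nil =>
        exact T.accepts_of_sweep ((hd l).2 [] rfl (by simpa using hl))
      | append_singleton u a =>
        have : (Sum.inl false : Bool ⊕ C) ∈ l.map Sum.inr ++ [Sum.inl true] := by
          simp at hl
          rw [← hl.2]
          simp
        simp at this
  | left q p X Y Z u v h =>
    rcases q with s | _ | _ <;> rcases X with (_ | _) | c <;>
      simp [toLBA] at h
    · have turn : ∀ l done : List C, Z :: u = (done.map .inr).reverse ++ [.inl false] →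
          Sum.inl true :: v = l.map .inr ++ [.inl true] → l = [] ∧
            u.reverse ++ (Z :: .inl true :: v) = .inl false :: (done.map .inr ++ [.inl true]) := by
        intro l done hu hv
        cases l with
        | cons => simp at hv
        | nil =>
          have := congrArg List.reverse hu
          simp at this hv
          rw [← List.singleton_append, ← List.append_assoc, this, hv]
          simp
      obtain ⟨hb, rfl, rfl⟩ | ⟨hb, rfl, rfl⟩ := h
      all_goals
        refine fun l => ⟨by simp, ?_⟩
        intro done hu hv
        obtain ⟨rfl, hl⟩ := turn l done hu hv
      · exact .inr ⟨hb, hd _ (by simpa [mealyRun] using hl)⟩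
      · exact .inl hb
    all_goals
      obtain ⟨rfl, rfl⟩ := h
      intro l hl
      exact hd l (by simpa using hl)

theorem sweep_run (s : S) (done l : List C) :
    Relation.ReflTransGen (T.toLBA inp hinp).Step
      (.inl s, (done.map .inr).reverse ++ [.inl false], l.map .inr ++ [.inl true])
      (.inl (T.sweep s l).1, ((done ++ (T.sweep s l).2).map .inr).reverse ++ [.inl false],
        [.inl true]) := by
  induction l generalizing s done with
  | nil => simp [mealyRun, Relation.ReflTransGen.refl]
  | cons c l ih =>
    refine .head ?_ (by simpa [mealyRun] using ih (T.step s c).1 (done ++ [(T.step s c).2]))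
    obtain ⟨Z, v, hv⟩ : ∃ Z v, l.map Sum.inr ++ [Sum.inl true] = (Z :: v : List (Bool ⊕ C)) := by
      cases l <;> simp
    simp only [List.map_cons, List.cons_append, hv]
    exact .right (M := T.toLBA inp hinp) _ _ _ _ _ _ _ rfl

theorem return_run (u : List C) (X : Bool ⊕ C) (v : List (Bool ⊕ C)) (hX : X ≠ .inl false) :
    Relation.ReflTransGen (T.toLBA inp hinp).Step
      (.inr false, u.map .inr ++ [.inl false], X :: v)
      (.inr false, [], .inl false :: ((u.map .inr).reverse ++ X :: v)) := by
  have hδ : ((.inr false, X, .left) : (S ⊕ Bool) × (Bool ⊕ C) × Turing.Dir) ∈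
      (T.toLBA inp hinp).δ (.inr false) X := by
    rcases X with (_ | _) | c <;> simp_all [toLBA]
  induction u generalizing X v with
  | nil => exact .single (.left _ _ _ _ _ _ _ hδ)
  | cons c u ih =>
    refine .head (.left _ _ _ _ _ _ _ hδ) ?_
    simpa using ih (.inr c) (X :: v) (by simp) rfl

theorem again_of_ret (l : List C) :
    (T.toLBA inp hinp).Step (.inr false, [], .inl false :: (l.map .inr ++ [.inl true]))
      (.inl T.again, [.inl false], l.map .inr ++ [.inl true]) := by
  obtain ⟨Z, v, hv⟩ : ∃ Z v, l.map Sum.inr ++ [Sum.inl true] = (Z :: v : List (Bool ⊕ C)) := by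
    cases l <;> simp
  rw [hv]
  exact .right (M := T.toLBA inp hinp) _ _ _ _ _ _ _ rfl

theorem Accepts.run {T : Sweeper S C} {s : S} {l : List C} (h : T.Accepts s l) :
    ∃ u v, Relation.ReflTransGen (T.toLBA inp hinp).Step
      (.inl s, [.inl false], l.map .inr ++ [.inl true]) (.inr true, u, v) := by
  -- at the right end marker, a verdict `b` moves the head left and enters state `inr b`
  have turn : ∀ (s : S) (l : List C) (b : Bool), T.verdict s = some b → ∃ Z u,
      (l.map .inr).reverse ++ [.inl false] = Z :: u ∧ (T.toLBA inp hinp).Step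
        (.inl s, (l.map .inr).reverse ++ [.inl false], [.inl true]) (.inr b, u, [Z, .inl true]) := by
    intro s l b hb
    obtain ⟨Z, u, hu⟩ : ∃ Z u, (l.map Sum.inr).reverse ++ [Sum.inl false] =
        (Z :: u : List (Bool ⊕ C)) := by
      rw [← List.map_reverse]
      cases l.reverse <;> simp
    refine ⟨Z, u, hu, ?_⟩
    rw [hu]
    exact .left (M := T.toLBA inp hinp) _ _ _ _ _ _ _ ⟨b, hb, rfl⟩
  induction h with
  | @accept s l h =>
    obtain ⟨Z, u, -, hs⟩ := turn _ (T.sweep s l).2 _ h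
    exact ⟨u, _, .tail (by simpa using T.sweep_run inp hinp s [] l) hs⟩
  | @again s l h _ ih =>
    obtain ⟨u', v', ih⟩ := ih
    obtain ⟨Z, u, hu, hs⟩ := turn _ (T.sweep s l).2 _ h
    refine ⟨u', v', .trans (.tail (by simpa using T.sweep_run inp hinp s [] l) hs) ?_⟩
    refine .trans ?_ (.head (T.again_of_ret inp hinp _) ih)
    cases hl : (T.sweep s l).2 using List.reverseRecOn with
    | nil =>
      rw [hl] at hu
      simp at hu
      obtain ⟨rfl, rfl⟩ := hu
      exact .refl
    | append_singleton l' c =>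
      rw [hl] at hu
      simp at hu
      obtain ⟨rfl, rfl⟩ := hu
      simpa using T.return_run inp hinp l'.reverse (.inr c) [.inl true] (by simp)

theorem mem_toLBA_language {w : List α} :
    w ∈ (T.toLBA inp hinp).language ↔ T.Accepts T.first (w.map inp) := by
  constructor
  · rintro ⟨q, rfl, u, v, h⟩
    have key : ∀ c, Relation.ReflTransGen (T.toLBA inp hinp).Step c (.inr true, u, v) →
        T.Promising c := by
      intro c h
      induction h using Relation.ReflTransGen.head_induction_on with
      | refl => trivial
      | head h _ ih => exact T.promising_of_step inp hinp h ih
    exact (key _ h (w.map inp)).1 rfl (by simp [toLBA])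
  · intro h
    obtain ⟨u, v, h⟩ := h.run inp hinp
    refine ⟨.inr true, rfl, u, v, .head ?_ h⟩
    obtain ⟨Z, v, hv⟩ : ∃ Z v, (w.map inp).map Sum.inr ++ [Sum.inl true] =
        (Z :: v : List (Bool ⊕ C)) := by
      cases w <;> simp
    have : (w.map (T.toLBA inp hinp).inp ++ [(T.toLBA inp hinp).rend]) = Z :: v := by
      rw [← hv]; simp [toLBA]
    rw [this, hv]
    exact .right (M := T.toLBA inp hinp) _ _ _ _ _ _ _ rfl

end Sweeper

/-! ### The machine for marked copies -/

/-- States of the matching component of a sweep: no letter found yet (`seek`); letter `b` erased,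
before the marker (`took b`) or after it (`cross b`); letter erased on both sides (`done`); marker
reached without finding a letter (`empty`); input rejected (`dead`). -/
inductive MatchState
  | seek
  | took (b : Bool)
  | cross (b : Bool)
  | done
  | empty
  | dead

namespace MatchState

/-- Encoding of the states used to count them. -/
def code : MatchState → Option (Bool ⊕ Bool) ⊕ Fin 3
  | seek => .inl none
  | took b => .inl (some (.inl b))
  | cross b => .inl (some (.inr b))
  | done => .inr 0
  | empty => .inr 1
  | dead => .inr 2

theorem code_injective : Function.Injective code := by
  intro s s' h
  cases s <;> cases s' <;> simp_all [code]

noncomputable instance : Fintype MatchState := Fintype.ofInjective code code_injective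

theorem card_le : Fintype.card MatchState ≤ 8 :=
  (Fintype.card_le_of_injective code code_injective).trans (by simp)

/-- The matching component. The letter `none` is an erased one, `some none` is the marker. -/
def step : MatchState → Option (Option Bool) → MatchState × Option (Option Bool)
  | seek, none => (seek, none)
  | seek, some (some b) => (took b, none)
  | seek, some none => (empty, some none)
  | took b, some none => (cross b, some none)
  | took b, c => (took b, c)
  | cross b, none => (cross b, none)
  | cross b, some (some b') => if b = b' then (done, none) else (dead, some (some b'))
  | cross _, some none => (dead, some none)
  | done, some none => (dead, some none)
  | done, c => (done, c)
  | empty, none => (empty, none)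
  | empty, some c => (dead, some c)
  | dead, c => (dead, c)

end MatchState

/-- The counter component: increment of a binary number, least significant bit first, stored in the
first cells. The state consists of the number of cells of the counter still ahead and the carry. -/
def counterStep {n : ℕ} : Fin (n + 1) × Bool → Bool → (Fin (n + 1) × Bool) × Bool
  | (⟨0, h⟩, c), b => ((⟨0, h⟩, c), b)
  | (⟨r + 1, h⟩, c), b => ((⟨r, by omega⟩, b && c), xor b c)

/-- The machine for `w$w`, `|w| = 2 ^ n`: one component erases, in every sweep, the first letter left
on each side of the marker; the other one keeps an `n`-bit counter, which is not changed in the first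
sweep and incremented in every later one. It accepts if the counter overflows in the sweep that
finds nothing left to erase. -/
def copySweeper (n : ℕ) :
    Sweeper (MatchState × Fin (n + 1) × Bool) (Option (Option Bool) × Bool) where
  step s c := (((s.1.step c.1).1, (counterStep s.2 c.2).1),
    ((s.1.step c.1).2, (counterStep s.2 c.2).2))
  first := (.seek, Fin.last n, false)
  again := (.seek, Fin.last n, true)
  verdict
    | (.done, r, c) => if r = 0 ∧ c = false then some false else none
    | (.empty, r, c) => if r = 0 ∧ c = true then some true else none
    | _ => none

theorem copySweeper_sweep (n : ℕ) (s : MatchState × Fin (n + 1) × Bool)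
    (l : List (Option (Option Bool) × Bool)) :
    ((copySweeper n).sweep s l).1 = ((mealyRun MatchState.step s.1 (l.map Prod.fst)).1,
      (mealyRun counterStep s.2 (l.map Prod.snd)).1) ∧
    ((copySweeper n).sweep s l).2.map Prod.fst =
      (mealyRun MatchState.step s.1 (l.map Prod.fst)).2 ∧
    ((copySweeper n).sweep s l).2.map Prod.snd = (mealyRun counterStep s.2 (l.map Prod.snd)).2 := by
  induction l generalizing s with
  | nil => simp [mealyRun]
  | cons c l ih =>
    obtain ⟨h1, h2, h3⟩ := ih ((copySweeper n).step s c).1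
    simp only [mealyRun, List.map_cons, h1, h2, h3]
    simp [copySweeper]

/-! ### The counter component -/

/-- The number stored in the first `r` cells. -/
def counterValue : ℕ → List Bool → ℕ
  | 0, _ => 0
  | _ + 1, [] => 0
  | r + 1, b :: l => b.toNat + 2 * counterValue r l

theorem counterValue_lt (r : ℕ) (l : List Bool) : counterValue r l < 2 ^ r := by
  induction r generalizing l with
  | zero => simp [counterValue]
  | succ r ih =>
    cases l with
    | nil => simp [counterValue]
    | cons b l =>
      have := ih l
      have := b.toNat_le
      simp only [counterValue, pow_succ]
      omega

theorem counterValue_replicate (r k : ℕ) : counterValue r (List.replicate k false) = 0 := by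
  induction r generalizing k with
  | zero => simp [counterValue]
  | succ r ih => cases k <;> simp [counterValue, List.replicate_succ, ih]

theorem counter_run_value {n r : ℕ} (hr : r < n + 1) (c : Bool) (l : List Bool)
    (h : (mealyRun counterStep ((⟨r, hr⟩ : Fin (n + 1)), c) l).1.1 = 0) :
    counterValue r l + c.toNat =
      counterValue r (mealyRun counterStep ((⟨r, hr⟩ : Fin (n + 1)), c) l).2 +
        2 ^ r * (mealyRun counterStep ((⟨r, hr⟩ : Fin (n + 1)), c) l).1.2.toNat := by
  induction l generalizing r c with
  | nil =>
    obtain rfl : r = 0 := by simpa [mealyRun, Fin.ext_iff] using h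
    simp [mealyRun, counterValue]
  | cons b l ih =>
    cases r with
    | zero =>
      have := ih hr c h
      simpa [counterValue, mealyRun, counterStep] using this
    | succ r =>
      have := ih (Nat.lt_of_succ_lt hr) (b && c) h
      simp only [counterValue, mealyRun, counterStep, pow_succ', mul_assoc]
      cases b <;> cases c <;> simp at this ⊢ <;> omega

theorem counter_run_finished {n r : ℕ} (hr : r < n + 1) (c : Bool) (l : List Bool)
    (hl : r ≤ l.length) : (mealyRun counterStep ((⟨r, hr⟩ : Fin (n + 1)), c) l).1.1 = 0 := by
  induction l generalizing r c with
  | nil => simpa [mealyRun, Fin.ext_iff] using hl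
  | cons b l ih =>
    cases r with
    | zero => exact ih hr c (by simp)
    | succ r => exact ih (Nat.lt_of_succ_lt hr) _ (by simpa using hl)

/-! ### The matching component

A sweep is described by its effect on `l.reduceOption`, the word of the letters not yet erased. -/

namespace MatchState

theorem run_dead (l : List (Option (Option Bool))) : (mealyRun step dead l).1 = dead := by
  induction l with
  | nil => rfl
  | cons c l ih => exact ih

theorem run_done_of_reduce {l : List (Option (Option Bool))} {v : List Bool}
    (h : l.reduceOption = v.map some) : mealyRun step done l = (done, l) := by
  induction l generalizing v with
  | nil => rfl
  | cons c l ih =>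
    rcases c with _ | _ | b
    · simp [mealyRun, step, ih h]
    · cases v <;> simp at h
    · cases v <;> simp at h
      simp [mealyRun, step, ih h.2]

theorem reduce_of_run_done {l : List (Option (Option Bool))} (h : (mealyRun step done l).1 = done) :
    ∃ v : List Bool, l.reduceOption = v.map some := by
  induction l with
  | nil => exact ⟨[], rfl⟩
  | cons c l ih =>
    rcases c with _ | _ | b
    · exact ih h
    · simp [mealyRun, step, run_dead] at h
    · obtain ⟨v, hv⟩ := ih h
      exact ⟨b :: v, by simp [hv]⟩

theorem run_cross_of_reduce {l : List (Option (Option Bool))} {b : Bool} {v : List Bool}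
    (h : l.reduceOption = some b :: v.map some) : (mealyRun step (cross b) l).1 = done ∧
      (mealyRun step (cross b) l).2.reduceOption = v.map some := by
  induction l with
  | nil => simp at h
  | cons c l ih =>
    rcases c with _ | _ | b'
    · exact ih h
    · simp at h
    · simp at h
      obtain ⟨rfl, h⟩ := h
      simp [mealyRun, step, run_done_of_reduce h, h]

theorem reduce_of_run_cross {l : List (Option (Option Bool))} {b : Bool}
    (h : (mealyRun step (cross b) l).1 = done) :
    ∃ v : List Bool, l.reduceOption = some b :: v.map some := by
  induction l with
  | nil => simp [mealyRun] at h
  | cons c l ih =>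
    rcases c with _ | _ | b'
    · exact ih h
    · simp [mealyRun, step, run_dead] at h
    · by_cases hb : b = b'
      · subst hb
        simp only [mealyRun, step, if_true] at h
        obtain ⟨v, hv⟩ := reduce_of_run_done h
        exact ⟨v, by simp [hv]⟩
      · simp [mealyRun, step, run_dead, hb] at h

theorem run_took_of_reduce {l : List (Option (Option Bool))} {b : Bool} {u v : List Bool}
    (h : l.reduceOption = u.map some ++ none :: some b :: v.map some) :
    (mealyRun step (took b) l).1 = done ∧
      (mealyRun step (took b) l).2.reduceOption = u.map some ++ none :: v.map some := by
  induction l generalizing u with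
  | nil => simp at h
  | cons c l ih =>
    rcases c with _ | _ | b'
    · exact ih h
    · cases u with
      | nil =>
        simp at h
        simpa [mealyRun, step] using run_cross_of_reduce h
      | cons => simp at h
    · cases u with
      | nil => simp at h
      | cons b u =>
        simp at h
        obtain ⟨rfl, h⟩ := h
        simpa [mealyRun, step] using ih h

theorem reduce_of_run_took {l : List (Option (Option Bool))} {b : Bool}
    (h : (mealyRun step (took b) l).1 = done) :
    ∃ u v : List Bool, l.reduceOption = u.map some ++ none :: some b :: v.map some := by
  induction l with
  | nil => simp [mealyRun] at h
  | cons c l ih =>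
    rcases c with _ | _ | b'
    · exact ih h
    · obtain ⟨v, hv⟩ := reduce_of_run_cross h
      exact ⟨[], v, by simp [hv]⟩
    · obtain ⟨u, v, hv⟩ := ih h
      exact ⟨b' :: u, v, by simp [hv]⟩

theorem run_ne_empty (l : List (Option (Option Bool))) (s : MatchState) (hs : s ≠ seek)
    (hs' : s ≠ empty) : (mealyRun step s l).1 ≠ empty := by
  induction l generalizing s with
  | nil => exact hs'
  | cons c l ih =>
    apply ih <;> rcases s with _ | _ | _ | _ | _ | _ <;> rcases c with _ | _ | _ <;>
      simp_all [step] <;> split_ifs <;> simp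

theorem run_empty_ne_done (l : List (Option (Option Bool))) :
    (mealyRun step empty l).1 ≠ done := by
  induction l with
  | nil => simp [mealyRun]
  | cons c l ih =>
    rcases c with _ | c
    · exact ih
    · simp [mealyRun, step, run_dead]

theorem run_empty_iff (l : List (Option (Option Bool))) :
    (mealyRun step empty l).1 = empty ↔ l.reduceOption = [] := by
  induction l with
  | nil => simp [mealyRun]
  | cons c l ih =>
    rcases c with _ | c
    · exact ih
    · simp [mealyRun, step, run_dead]

theorem run_seek_of_reduce {l : List (Option (Option Bool))} {b : Bool} {u v : List Bool}
    (h : l.reduceOption = (b :: u).map some ++ none :: (b :: v).map some) :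
    (mealyRun step seek l).1 = done ∧
      (mealyRun step seek l).2.reduceOption = u.map some ++ none :: v.map some := by
  induction l with
  | nil => simp at h
  | cons c l ih =>
    rcases c with _ | _ | b'
    · exact ih h
    · simp at h
    · simp at h
      obtain ⟨rfl, h⟩ := h
      simpa [mealyRun, step] using run_took_of_reduce h

theorem reduce_of_run_seek {l : List (Option (Option Bool))} (h : (mealyRun step seek l).1 = done) :
    ∃ (b : Bool) (u v : List Bool),
      l.reduceOption = (b :: u).map some ++ none :: (b :: v).map some := by
  induction l with
  | nil => simp [mealyRun] at h
  | cons c l ih =>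
    rcases c with _ | _ | b
    · exact ih h
    · exact absurd h (run_empty_ne_done l)
    · obtain ⟨u, v, hv⟩ := reduce_of_run_took h
      exact ⟨b, u, v, by simp [hv]⟩

theorem run_seek_eq_empty_iff (l : List (Option (Option Bool))) :
    (mealyRun step seek l).1 = empty ↔ l.reduceOption = [none] := by
  induction l with
  | nil => simp [mealyRun]
  | cons c l ih =>
    rcases c with _ | _ | b
    · exact ih
    · simpa [mealyRun, step] using run_empty_iff l
    · simpa [mealyRun, step] using run_ne_empty l (took b) (by simp) (by simp)

end MatchState

/-! ### Correctness of the machine -/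

theorem copy_shape_unique {u v w : List Bool}
    (h : u.map some ++ none :: v.map some = w.map some ++ none :: w.map some) : u = w ∧ v = w := by
  have key : ∀ w' : List Bool,
      u.map some ++ none :: v.map some = w'.map some ++ none :: w.map some → u = w' ∧ v = w := by
    clear h
    induction u with
    | nil =>
      intro w' h
      cases w' with
      | nil =>
        simp at h
        exact ⟨rfl, (List.map_injective_iff.2 (Option.some_injective _)) h⟩
      | cons => simp at h
    | cons b u ih =>
      intro w' h
      cases w' with
      | nil => simp at h
      | cons b' w' =>
        simp at h
        obtain ⟨h1, h2⟩ := ih w' h.2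
        exact ⟨by rw [h.1, h1], h2⟩
  exact key w h

/-- From an accepting iteration one recovers, going back from its last sweep, that the letters left on
the two sides of the marker agree, and that their number is what the counter, including the pending
increment, lacks of `2 ^ n`. -/
theorem copySweeper_sound {n : ℕ} {s : MatchState × Fin (n + 1) × Bool}
    {l : List (Option (Option Bool) × Bool)} (h : (copySweeper n).Accepts s l) (c : Bool)
    (hs : s = (.seek, Fin.last n, c)) :
    ∃ u : List Bool, (l.map Prod.fst).reduceOption = u.map some ++ none :: u.map some ∧
      counterValue n (l.map Prod.snd) + c.toNat + u.length = 2 ^ n := by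
  induction h generalizing c with
  | @accept s l h =>
    subst hs
    obtain ⟨h1, -, -⟩ := copySweeper_sweep n (.seek, Fin.last n, c) l
    rw [h1] at h
    have hv := counter_run_value (Nat.lt_succ_self n) c (l.map Prod.snd)
    have hlt := counterValue_lt n (l.map Prod.snd)
    simp only [Fin.last] at h hv
    generalize hm : (mealyRun MatchState.step .seek (l.map Prod.fst)).1 = m at h
    generalize mealyRun counterStep _ _ = k at h hv
    obtain ⟨⟨r, c'⟩, k⟩ := k
    cases m <;> simp [copySweeper] at h
    obtain ⟨rfl, rfl⟩ := h
    have hv := hv rfl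
    refine ⟨[], by simpa using (MatchState.run_seek_eq_empty_iff _).1 hm, ?_⟩
    have := c.toNat_le
    simp at hv ⊢
    omega
  | @again s l h _ ih =>
    subst hs
    obtain ⟨u, hu, hul⟩ := ih true rfl
    obtain ⟨h1, h2, h3⟩ := copySweeper_sweep n (.seek, Fin.last n, c) l
    rw [h2] at hu
    rw [h3] at hul
    rw [h1] at h
    have hv := counter_run_value (Nat.lt_succ_self n) c (l.map Prod.snd)
    simp only [Fin.last] at h hv hul
    generalize hm : (mealyRun MatchState.step .seek (l.map Prod.fst)).1 = m at h
    generalize mealyRun counterStep _ _ = k at h hv hul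
    obtain ⟨⟨r, c'⟩, k⟩ := k
    cases m <;> simp [copySweeper] at h
    obtain ⟨rfl, rfl⟩ := h
    have hv := hv rfl
    obtain ⟨b, u', v', hb⟩ := MatchState.reduce_of_run_seek hm
    rw [(MatchState.run_seek_of_reduce hb).2] at hu
    obtain ⟨rfl, rfl⟩ := copy_shape_unique hu
    refine ⟨_, hb, ?_⟩
    simp at hv hul ⊢
    omega

theorem copySweeper_complete {n : ℕ} (u : List Bool) (c : Bool)
    (l : List (Option (Option Bool) × Bool)) (hn : n ≤ l.length)
    (hu : (l.map Prod.fst).reduceOption = u.map some ++ none :: u.map some)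
    (hl : counterValue n (l.map Prod.snd) + c.toNat + u.length = 2 ^ n) :
    (copySweeper n).Accepts (.seek, Fin.last n, c) l := by
  induction u generalizing c l with
  | nil =>
    apply Sweeper.Accepts.accept
    rw [(copySweeper_sweep n (.seek, Fin.last n, c) l).1]
    have hf := counter_run_finished (Nat.lt_succ_self n) c (l.map Prod.snd) (by simpa using hn)
    have hv := counter_run_value (Nat.lt_succ_self n) c (l.map Prod.snd) hf
    have hm := (MatchState.run_seek_eq_empty_iff (l.map Prod.fst)).2 (by simpa using hu)
    have hlt := counterValue_lt n (mealyRun counterStep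
      ((⟨n, Nat.lt_succ_self n⟩ : Fin (n + 1)), c) (l.map Prod.snd)).2
    simp only [Fin.last]
    generalize mealyRun counterStep _ _ = k at hf hv hlt ⊢
    obtain ⟨⟨r, c'⟩, k⟩ := k
    simp only at hf hv hlt hm ⊢
    subst hf
    rw [hm]
    cases c' with
    | true => simp [copySweeper]
    | false => simp at hl hv; omega
  | cons b u ih =>
    obtain ⟨h1, h2, h3⟩ := copySweeper_sweep n (.seek, Fin.last n, c) l
    obtain ⟨hm, hr⟩ := MatchState.run_seek_of_reduce hu
    have hf := counter_run_finished (Nat.lt_succ_self n) c (l.map Prod.snd) (by simpa using hn)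
    have hv := counter_run_value (Nat.lt_succ_self n) c (l.map Prod.snd) hf
    simp only [Fin.last] at h1 h2 h3
    generalize mealyRun counterStep _ _ = k at hf hv h1 h2 h3
    obtain ⟨⟨r, c'⟩, k⟩ := k
    simp only at hf hv h1 h2 h3
    subst hf
    -- an overflow would contradict the presence of a letter still to be erased
    obtain rfl : c' = false := by
      cases c' with
      | false => rfl
      | true => simp at hl hv; omega
    refine .again ?_ (ih true _ ?_ ?_ ?_)
    · rw [Sweeper.sweep, Fin.last, h1, hm]
      simp [copySweeper]
    · simpa [Sweeper.sweep, mealyRun_length] using hn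
    · rw [Fin.last, h2]
      exact hr
    · rw [Fin.last, h3]
      simp at hl hv ⊢
      omega

theorem blankCell_injective :
    Function.Injective fun a : Option Bool => ((some a, false) : Option (Option Bool) × Bool) :=
  fun a b h => by simpa using h

/-- The linear bounded automaton that runs `copySweeper n`; every cell starts with counter
digit `0`. -/
def copyLBA (n : ℕ) : LBA (Option Bool) ((MatchState × Fin (n + 1) × Bool) ⊕ Bool)
    (Bool ⊕ (Option (Option Bool) × Bool)) :=
  (copySweeper n).toLBA (fun a => (some a, false)) blankCell_injective

theorem copyLBA_language (n : ℕ) : (copyLBA n).language = markedCopies (2 ^ n) := by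
  ext x
  have hf : ((x.map fun a => (some a, false)).map Prod.fst).reduceOption = x := by
    induction x with
    | nil => rfl
    | cons a x ih => simpa using ih
  have hc : counterValue n ((x.map fun a => (some a, false)).map Prod.snd) = 0 := by
    rw [List.map_map, show (Prod.snd ∘ fun a : Option Bool => (some a, false)) =
      Function.const _ false from rfl, List.map_const]
    exact counterValue_replicate _ _
  rw [copyLBA, Sweeper.mem_toLBA_language]
  constructor
  · intro h
    obtain ⟨u, hu, hul⟩ := copySweeper_sound h false rfl
    rw [hf] at hu
    rw [hc] at hul
    exact ⟨u, by simpa using hul, hu⟩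
  · rintro ⟨u, hul, hu⟩
    refine copySweeper_complete u false _ ?_ (hf.trans hu) (by rw [hc]; simpa using hul)
    have := Nat.lt_two_pow_self (n := n)
    simp [hu, hul]
    omega

theorem copyLBA_size (n : ℕ) : (copyLBA n).size ≤ 16 * n + 30 := by
  have := MatchState.card_le
  simp only [LBA.size, Fintype.card_sum, Fintype.card_prod, Fintype.card_fin, Fintype.card_bool,
    Fintype.card_option]
  nlinarith

/-! ### The bounds -/

namespace PDA

theorem two_pow_le_of_language_eq_markedCopies_two_pow {Q Γ : Type} [Fintype Q] [Fintype Γ]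
    (P : PDA (Option Bool) Q Γ) {n : ℕ} (hn : 1 ≤ n) (hP : P.language = markedCopies (2 ^ n)) :
    2 ^ 2 ^ (n - 1) ≤ (P.size + 1) ^ 3 * (2 ^ (n + 2)) ^ 2 := by
  obtain ⟨k, rfl⟩ := Nat.exists_eq_add_of_le' hn
  have h := P.two_pow_le_of_language_eq_markedCopies (t := 2 ^ k) Nat.one_le_two_pow
    (by rw [pow_succ']) hP
  have hm : 2 ^ (k + 1) = 2 ^ (k + 1) - 2 ^ k + 2 ^ k := by rw [pow_succ]; omega
  nth_rw 1 [hm] at h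
  rw [pow_add] at h
  refine (Nat.le_of_mul_le_mul_left h (by positivity)).trans ?_
  have h1 : Fintype.card Q + 1 ≤ P.size + 1 := by simp [size]
  have h2 : Fintype.card Γ + 1 ≤ P.size + 1 := by simp [size]
  have h3 : 2 * 2 ^ (k + 1) + 2 ≤ 2 ^ (k + 1 + 2) := by
    have := Nat.one_le_two_pow (n := k + 1)
    rw [pow_add _ (k + 1)]
    omega
  rw [pow_succ (P.size + 1)]
  gcongr

/-- The exponent `1 / 2`: with `y = 2 ^ (n / 2)`, a size below `2 ^ y` would bound `2 ^ (y ^ 2 / 2)` by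
`2 ^ (3 * y + O(n))`. -/
theorem two_pow_two_pow_le_size {Q Γ : Type} [Fintype Q] [Fintype Γ]
    (P : PDA (Option Bool) Q Γ) {n : ℕ} (hn : 10 ≤ n) (hP : P.language = markedCopies (2 ^ n)) :
    (2 : ℝ) ^ ((2 : ℝ) ^ ((1 / 2 : ℝ) * (n : ℝ))) ≤ (P.size : ℝ) := by
  by_contra! hlt
  have h := P.two_pow_le_of_language_eq_markedCopies_two_pow (by omega) hP
  set y : ℝ := (2 : ℝ) ^ ((1 / 2 : ℝ) * (n : ℝ)) with hy
  have hn' : (10 : ℝ) ≤ n := by exact_mod_cast hn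
  have hy32 : 32 ≤ y := by
    have : (2 : ℝ) ^ (5 : ℝ) ≤ y := Real.rpow_le_rpow_of_exponent_le (by norm_num) (by linarith)
    norm_num at this
    linarith
  have hyy : y ^ 2 = 2 * 2 ^ (n - 1) := by
    rw [hy, ← Real.rpow_natCast, ← Real.rpow_mul (by norm_num), ← pow_succ',
      Nat.sub_add_cancel (by omega), ← Real.rpow_natCast]
    congr 1
    push_cast
    ring
  have hny : (n : ℝ) ≤ 3 * y := by
    have h1 : y = Real.exp (Real.log 2 * (1 / 2 * n)) := by
      rw [hy, Real.rpow_def_of_pos (by norm_num)]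
    have h2 := Real.add_one_le_exp (Real.log 2 * (1 / 2 * n))
    have h3 := Real.log_two_gt_d9
    rw [← h1] at h2
    nlinarith
  have hs : (P.size : ℝ) + 1 ≤ 2 ^ (y + 1) := by
    have : (1 : ℝ) ≤ 2 ^ y := Real.one_le_rpow (by norm_num) (by linarith)
    rw [Real.rpow_add_one (by norm_num)]
    linarith
  have hR : (2 : ℝ) ^ (2 ^ (n - 1) : ℝ) ≤ (2 ^ (y + 1)) ^ 3 * (2 ^ ((n : ℝ) + 2)) ^ 2 := by
    have h' : (2 : ℝ) ^ 2 ^ (n - 1) ≤ (P.size + 1) ^ 3 * (2 ^ (n + 2)) ^ 2 := by exact_mod_cast h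
    have e1 : (2 : ℝ) ^ (2 ^ (n - 1) : ℝ) = 2 ^ 2 ^ (n - 1) := by
      exact_mod_cast Real.rpow_natCast 2 (2 ^ (n - 1))
    have e2 : (2 : ℝ) ^ ((n : ℝ) + 2) = 2 ^ (n + 2) := by
      rw [← Real.rpow_natCast]; push_cast; rfl
    rw [e1, e2]
    refine h'.trans ?_
    gcongr
  rw [← Real.rpow_mul_natCast (by norm_num), ← Real.rpow_mul_natCast (by norm_num),
    ← Real.rpow_add (by norm_num), Real.rpow_le_rpow_left_iff (by norm_num)] at hR
  push_cast at hR
  nlinarith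

end PDA

theorem mainTheorem8 :
    ∃ c C : ℝ, 0 < c ∧ 0 < C ∧ ∀ᶠ n : ℕ in atTop,
      -- the language is recognized by some PDA
      (∃ (Q Γ : Type) (_ : Fintype Q) (_ : Fintype Γ) (P : PDA (Option Bool) Q Γ),
        P.language = markedCopies (2 ^ n)) ∧
      -- every PDA that recognizes it is large
      (∀ (Q Γ : Type) [Fintype Q] [Fintype Γ] (P : PDA (Option Bool) Q Γ),
        P.language = markedCopies (2 ^ n) →
          (2 : ℝ) ^ ((2 : ℝ) ^ (c * (n : ℝ))) ≤ (P.size : ℝ)) ∧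
      -- some LBA that recognizes it is small
      (∃ (Q Γ : Type) (_ : Fintype Q) (_ : Fintype Γ) (M : LBA (Option Bool) Q Γ),
        M.language = markedCopies (2 ^ n) ∧ (M.size : ℝ) ≤ C * (n : ℝ)) := by
  refine ⟨1 / 2, 46, by norm_num, by norm_num, ?_⟩
  filter_upwards [eventually_ge_atTop 10] with n hn
  refine ⟨?_, fun Q Γ _ _ P hP => P.two_pow_two_pow_le_size hn hP, ?_⟩
  · have : Finite {l : List (Option Bool) // l.length ≤ 2 * 2 ^ n + 1} :=
      (List.finite_length_le (Option Bool) (2 * 2 ^ n + 1)).to_subtype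
    exact ⟨_, Empty, Fintype.ofFinite _, inferInstance, PDA.trie (markedCopies (2 ^ n)) _,
      PDA.trie_language _ _ fun w hw => (length_of_mem_markedCopies hw).le⟩
  · refine ⟨_, _, inferInstance, inferInstance, copyLBA n, copyLBA_language n, ?_⟩
    have h : (copyLBA n).size ≤ 46 * n := (copyLBA_size n).trans (by omega)
    exact_mod_cast h
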